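/- A (finite) partial-monitoring game with $N$ actions for Learner and $M$ actions for Nature is a pair $\mathbf G=(\mathbf L,\mathbf H)$ of real $N\times M$ matrices, the loss matrix $\mathbf L=(\ell_{ij})$ and the feedback matrix $\mathbf H=(h_{ij})$. Nature fixes a sequence of outcomes $J_1,J_2,\ldots\in\{1,\ldots,M\}$ in advance. At each time step $t=1,2,\ldots$, Learner chooses, possibly at random, an action $I_t\in\{1,\ldots,N\}$ based on his past actions and past feedback, and then observes only the feedback $h_{I_t,J_t}$ and suffers the loss $\ell_{I_t,J_t}$. For a strategy $\mathcal A$ of Learner, the regret against $J_1,\ldots,J_T$ is $$R_T(\mathcal A,\mathbf G)=\mathbb E\Big[\sum_{t=1}^T\ell_{I_t,J_t}-\min_{1\le i\le N}\sum_{t=1}^T\ell_{i,J_t}\Big],$$ and the minimax regret is $R_T^*(\mathbf G)=\inf_{\mathcal A}\sup_{(J_1,\ldots,J_T)}R_T(\mathcal A,\mathbf G)$, the infimum being over all strategies. The game is trivial if $R_T^*(\mathbf G)=0$ for all $T$ or $R_T^*(\mathbf G)=\Theta(T)$ as $T\to\infty$, and non-trivial otherwise. It is a bandit game if $\mathbf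 H=\mathbf L$. For two $N\times M$ games, $\mathbf G$ is easier (simulation-and-regret-not-harder) than $\mathbf G'$, written $\mathbf G\le\mathbf G'$, if for every strategy $\mathcal A'$ there is a strategy $\mathcal A$ such that, for every $T$ and every outcome sequence $(J_1,\ldots,J_T)$, the random action sequence $(I_1,\ldots,I_T)$ chosen by $\mathcal A$ in $\mathbf G$ has the same distribution as the one chosen by $\mathcal A'$ in $\mathbf G'$, and $R_T(\mathcal A,\mathbf G)\le R_T(\mathcal A',\mathbf G')$. Theorem. Let $\mathbf G$ be a non-trivial partial-monitoring game in which Learner has $N=2$ actions and Nature has $M$ actions. Then there is a $2\times M$ bandit game $\mathbf G'$ (with real entries) such that $\mathbf G\le\mathbf G'$. Moreover, the minimax regret of $\mathbf G$ is $\Theta(\sqrt T)$: there are constants $c,C>0$, depending only on $\mathbf G$, such that $c\sqrt T\le R_T^*(\mathbf G)\le C\sqrt T$ for every $T$. -/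

import Mathlib

open Filter Asymptotics

namespace PartialMonitoring

/-- A finite partial-monitoring game in which Learner has `N` actions and Nature has `M` actions:
a real loss matrix `L` and a feedback matrix `H` (with feedback symbols encoded as reals). -/
structure Game (N M : ℕ) where
  /-- The loss matrix. -/
  L : Matrix (Fin N) (Fin M) ℝ
  /-- The feedback matrix. -/
  H : Matrix (Fin N) (Fin M) ℝ

/-- A randomized strategy of Learner: for every time step `t` (counted from `0`) and every history
of the `t` actions played and the `t` feedback symbols received so far, a probability distribution
on Learner's actions. The losses suffered are not part of the history. -/
def Strategy (N : ℕ) : Type :=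
  (t : ℕ) → (Fin t → Fin N × ℝ) → stdSimplex ℝ (Fin N)

namespace Game

variable {N M : ℕ}

/-- What Learner has observed in `G` before time step `t`, when he plays the action sequence `a`
against the outcome sequence `J`. -/
def history (G : Game N M) {T : ℕ} (J : Fin T → Fin M) (a : Fin T → Fin N) (t : Fin T) :
    Fin (t : ℕ) → Fin N × ℝ :=
  fun s => (a (Fin.castLE t.isLt.le s), G.H (a (Fin.castLE t.isLt.le s)) (J (Fin.castLE t.isLt.le s)))

/-- The probability that strategy `A`, run in the game `G` against the outcome sequence `J`,
chooses the action sequence `a` in the first `T` time steps. -/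
noncomputable def actionProb (G : Game N M) (A : Strategy N) {T : ℕ} (J : Fin T → Fin M)
    (a : Fin T → Fin N) : ℝ :=
  ∏ t : Fin T, (A t (G.history J a t)).1 (a t)

/-- The cumulative loss `∑ₜ L (a t) (J t)` of an action sequence. -/
noncomputable def cumulativeLoss (G : Game N M) {T : ℕ} (J : Fin T → Fin M)
    (a : Fin T → Fin N) : ℝ :=
  ∑ t : Fin T, G.L (a t) (J t)

/-- The cumulative loss of the best fixed action in hindsight. -/
noncomputable def bestFixedLoss (G : Game N M) {T : ℕ} (J : Fin T → Fin M) : ℝ :=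
  ⨅ i : Fin N, ∑ t : Fin T, G.L i (J t)

/-- The cumulative expected regret of strategy `A` in `G` against the outcome sequence `J`:
the expectation of (cumulative loss minus loss of the best fixed action) over the random
action sequence of `A`. -/
noncomputable def regret (G : Game N M) (A : Strategy N) {T : ℕ} (J : Fin T → Fin M) : ℝ :=
  ∑ a : Fin T → Fin N, G.actionProb A J a * (G.cumulativeLoss J a - G.bestFixedLoss J)

/-- The worst-case regret of strategy `A` for time horizon `T`. -/
noncomputable def worstRegret (G : Game N M) (A : Strategy N) (T : ℕ) : ℝ :=
  ⨆ J : Fin T → Fin M, G.regret A J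

/-- The minimax regret of `G` for time horizon `T`. -/
noncomputable def minimaxRegret (G : Game N M) (T : ℕ) : ℝ :=
  ⨅ A : Strategy N, G.worstRegret A T

/-- A game is trivial if its minimax regret is zero or scales linearly with the number of time
steps. -/
def IsTrivial (G : Game N M) : Prop :=
  (∀ T : ℕ, G.minimaxRegret T = 0) ∨
    (fun T : ℕ => G.minimaxRegret T) =Θ[atTop] (fun T : ℕ => (T : ℝ))

/-- A bandit game: the feedback is the loss of the action taken. -/
def IsBandit (G : Game N M) : Prop :=
  G.H = G.L

/-- `G'.Easier G`: the game `G'` is simulation-and-regret-not-harder than `G`. Every strategy `A`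
for `G` can be replicated in `G'` by some strategy `A'`: against every outcome sequence (of any
length `T`) the random action sequences chosen by `A'` in `G'` and by `A` in `G` have the same law,
and the regret of `A'` in `G'` is at most the regret of `A` in `G`. -/
def Easier (G' G : Game N M) : Prop :=
  ∀ A : Strategy N, ∃ A' : Strategy N, ∀ (T : ℕ) (J : Fin T → Fin M),
    (∀ a : Fin T → Fin N, G'.actionProb A' J a = G.actionProb A J a) ∧
      G'.regret A' J ≤ G.regret A J

end Game

end PartialMonitoring

/-!
A two-action game is governed by the excess loss `d j` of one action over the other under outcome
`j` (`Game.lossDiff`). If `d` does not change sign, one action dominates and the minimax regret is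
`0` (`Game.minimaxRegret_eq_zero_of_dominant`). Hence in a non-trivial game `d` takes both signs, and
there is an outcome distribution `p` of full support under which `d` has mean `0`
(`Game.exists_balanced_distribution`).

By linear duality (`Game.exists_estimator_or_exists_perturbation`) one of two things happens.

* There is a signed measure `v` on the outcomes that no action can see through its feedback and for
  which `∑ j, v j * d j ≠ 0`. Against i.i.d. outcomes with law `p + ε v` or `p - ε v` Learner then
  acts in the same way, although different actions are optimal by a fixed margin. The minimax regret
  is therefore linear (`Game.exists_mul_le_minimaxRegret`) and the game is trivial.
* There are functions `f 0`, `f 1` of the feedback symbols with `d j = f 1 (H 1 j) - f 0 (H 0 j)`.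
  The matrix with entries `f i (H i j)` defines a bandit game with the same loss differences, hence
  with the same regret, whose feedback can be computed from that of the given game
  (`Game.exists_bandit_of_estimator`).

In the second case the upper bound `O(√T)` is that of the strategy Exp3 in the bandit game
(`Game.IsBandit.exists_minimaxRegret_le_sqrt`); the horizon is fixed, so its learning rate may depend
on `T`, and after a shift the losses are nonnegative, which makes mixing with uniform exploration
unnecessary. For the lower bound, let the outcomes be i.i.d. with law `p`: both actions have the same
mean loss, so the mean regret of every strategy is half the mean absolute value of the centred random
walk `∑ t, d (J t)`, which is of order `√T` by a comparison of its second and fourth moments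
(`Game.exists_sqrt_le_minimaxRegret`).
-/

namespace PartialMonitoring

/-! ### Expectations over action sequences and over i.i.d. outcomes -/

theorem sum_snoc {α : Type*} [Fintype α] {T : ℕ} (F : (Fin (T + 1) → α) → ℝ) :
    ∑ b, F b = ∑ a : Fin T → α, ∑ x, F (Fin.snoc (α := fun _ => α) a x) := by
  rw [← (Fin.snocEquiv fun _ : Fin (T + 1) => α).sum_comp, Fintype.sum_prod_type, Finset.sum_comm]
  rfl

/-- The expectation of `F` when the `T` outcomes are drawn independently with the weights `p`;
the weights are not required to be nonnegative or to have sum `1`. -/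
noncomputable def iidExpect {M : ℕ} (p : Fin M → ℝ) (T : ℕ) (F : (Fin T → Fin M) → ℝ) : ℝ :=
  ∑ J : Fin T → Fin M, (∏ t, p (J t)) * F J

section iidExpect

variable {M T : ℕ} {p : Fin M → ℝ}

theorem iidExpect_zero (F : (Fin 0 → Fin M) → ℝ) : iidExpect p 0 F = F ![] := by
  simp [iidExpect, Subsingleton.elim (default : Fin 0 → Fin M) ![]]

theorem iidExpect_succ (F : (Fin (T + 1) → Fin M) → ℝ) :
    iidExpect p (T + 1) F =
      iidExpect p T fun J => ∑ j, p j * F (Fin.snoc (α := fun _ => Fin M) J j) := by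
  simp only [iidExpect, sum_snoc, Fin.prod_univ_castSucc, Fin.snoc_castSucc, Fin.snoc_last,
    Finset.mul_sum, mul_assoc]

theorem iidExpect_add (F₁ F₂ : (Fin T → Fin M) → ℝ) :
    iidExpect p T (fun J => F₁ J + F₂ J) = iidExpect p T F₁ + iidExpect p T F₂ := by
  simp only [iidExpect, mul_add, Finset.sum_add_distrib]

theorem iidExpect_const_mul (c : ℝ) (F : (Fin T → Fin M) → ℝ) :
    iidExpect p T (fun J => c * F J) = c * iidExpect p T F := by
  simp only [iidExpect, Finset.mul_sum, mul_left_comm]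

theorem iidExpect_sub (F₁ F₂ : (Fin T → Fin M) → ℝ) :
    iidExpect p T (fun J => F₁ J - F₂ J) = iidExpect p T F₁ - iidExpect p T F₂ := by
  simp only [iidExpect, mul_sub, Finset.sum_sub_distrib]

theorem iidExpect_const (hp : ∑ j, p j = 1) (c : ℝ) : iidExpect p T (fun _ => c) = c := by
  induction T with
  | zero => exact iidExpect_zero _
  | succ T ih => rw [iidExpect_succ]; simpa [← Finset.sum_mul, hp] using ih

theorem iidExpect_mono (hp : ∀ j, 0 ≤ p j) {F₁ F₂ : (Fin T → Fin M) → ℝ}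
    (h : ∀ J, F₁ J ≤ F₂ J) : iidExpect p T F₁ ≤ iidExpect p T F₂ :=
  Finset.sum_le_sum fun J _ =>
    mul_le_mul_of_nonneg_left (h J) (Finset.prod_nonneg fun t _ => hp (J t))

theorem iidExpect_sum (hp : ∑ j, p j = 1) (d : Fin M → ℝ) :
    iidExpect p T (fun J => ∑ t, d (J t)) = T * ∑ j, p j * d j := by
  induction T with
  | zero => simp [iidExpect_zero]
  | succ T ih =>
    simp only [iidExpect_succ, Fin.sum_univ_castSucc, Fin.snoc_castSucc, Fin.snoc_last, mul_add,
      Finset.sum_add_distrib, ← Finset.sum_mul, hp, one_mul]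
    rw [iidExpect_add, ih, iidExpect_const hp]
    push_cast
    ring

/-- The second moment of a centred random walk. -/
theorem iidExpect_sum_sq (hp : ∑ j, p j = 1) (d : Fin M → ℝ) (hd : ∑ j, p j * d j = 0) :
    iidExpect p T (fun J => (∑ t, d (J t)) ^ 2) = T * ∑ j, p j * d j ^ 2 := by
  induction T with
  | zero => simp [iidExpect_zero]
  | succ T ih =>
    have key : ∀ S : ℝ, ∑ j, p j * (S + d j) ^ 2 = S ^ 2 + ∑ j, p j * d j ^ 2 := fun S => by
      calc ∑ j, p j * (S + d j) ^ 2
          = ∑ j, (p j * S ^ 2 + p j * d j * (2 * S) + p j * d j ^ 2) :=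
            Finset.sum_congr rfl fun j _ => by ring
        _ = _ := by
            simp only [Finset.sum_add_distrib, ← Finset.sum_mul, hp, hd]; ring
    simp only [iidExpect_succ, Fin.sum_univ_castSucc, Fin.snoc_castSucc, Fin.snoc_last, key]
    rw [iidExpect_add, ih, iidExpect_const hp]
    push_cast
    ring

/-- The fourth moment of a centred random walk grows only quadratically. -/
theorem iidExpect_sum_pow_four_le (hp₀ : ∀ j, 0 ≤ p j) (hp : ∑ j, p j = 1) (d : Fin M → ℝ)
    (hd : ∑ j, p j * d j = 0) :
    iidExpect p T (fun J => (∑ t, d (J t)) ^ 4) ≤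
      (3 * (∑ j, p j * d j ^ 2) ^ 2 + ∑ j, p j * d j ^ 4) * T ^ 2 := by
  have hm : 0 ≤ ∑ j, p j * d j ^ 4 :=
    Finset.sum_nonneg fun j _ => mul_nonneg (hp₀ j) (by positivity)
  induction T with
  | zero => simp [iidExpect_zero]
  | succ T ih =>
    have key : ∀ S : ℝ, ∑ j, p j * (S + d j) ^ 4 = S ^ 4 + (6 * (∑ j, p j * d j ^ 2)) * S ^ 2
        + (4 * (∑ j, p j * d j ^ 3)) * S + ∑ j, p j * d j ^ 4 := fun S => by
      calc ∑ j, p j * (S + d j) ^ 4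
          = ∑ j, (p j * S ^ 4 + p j * d j * (4 * S ^ 3) + p j * d j ^ 2 * (6 * S ^ 2)
              + p j * d j ^ 3 * (4 * S) + p j * d j ^ 4) :=
            Finset.sum_congr rfl fun j _ => by ring
        _ = _ := by
            simp only [Finset.sum_add_distrib, ← Finset.sum_mul, hp, hd]; ring
    simp only [iidExpect_succ, Fin.sum_univ_castSucc, Fin.snoc_castSucc, Fin.snoc_last, key]
    rw [iidExpect_add, iidExpect_add, iidExpect_add, iidExpect_const hp, iidExpect_const_mul,
      iidExpect_const_mul, iidExpect_sum_sq hp d hd, iidExpect_sum hp d, hd]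
    push_cast
    nlinarith [sq_nonneg (∑ j, p j * d j ^ 2), mul_nonneg hm (Nat.cast_nonneg (α := ℝ) T)]

/-- The mean absolute value of a centred random walk is at least of order `√T`. It is bounded below
through its second and fourth moments. -/
theorem exists_sqrt_le_iidExpect_abs_sum (hp₀ : ∀ j, 0 ≤ p j) (hp : ∑ j, p j = 1) (d : Fin M → ℝ)
    (hd : ∑ j, p j * d j = 0) (hv : 0 < ∑ j, p j * d j ^ 2) :
    ∃ c : ℝ, 0 < c ∧ ∀ T : ℕ, c * √T ≤ iidExpect p T (fun J => |∑ t, d (J t)|) := by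
  set v := ∑ j, p j * d j ^ 2
  set K := 3 * v ^ 2 + ∑ j, p j * d j ^ 4 with hK
  have hm : 0 ≤ ∑ j, p j * d j ^ 4 :=
    Finset.sum_nonneg fun j _ => mul_nonneg (hp₀ j) (by positivity)
  have hK₀ : 0 < K := by positivity
  -- With `b = B √T`, integrating `|x| ≥ x² / b - x⁴ / b³` gives `√T (v / B - K / B³)`; the choice
  -- of `B` makes the second term half of the first.
  set B := √(2 * K / v) with hB
  have hB₀ : 0 < B := by positivity
  have hB2 : K = v * B ^ 2 / 2 := by
    rw [hB, Real.sq_sqrt (by positivity)]; field_simp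
  refine ⟨v / (2 * B), by positivity, fun T => ?_⟩
  rcases Nat.eq_zero_or_pos T with rfl | hT
  · simp [iidExpect_zero]
  have hs : 0 < √(T : ℝ) := by positivity
  have hs2 : √(T : ℝ) ^ 2 = T := Real.sq_sqrt (by positivity)
  set s := √(T : ℝ)
  have key : ∀ x : ℝ, 1 / (B * s) * x ^ 2 - 1 / (B * s) ^ 3 * x ^ 4 ≤ |x| := fun x => by
    have hb : 0 < B * s := by positivity
    generalize B * s = b at hb
    have hy : 0 ≤ |x| / b := by positivity
    have h1 : (|x| / b) ^ 2 - (|x| / b) ^ 4 ≤ |x| / b := by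
      rcases le_total (|x| / b) 1 with h | h
      · nlinarith [pow_nonneg hy 4]
      · nlinarith [mul_nonneg (sq_nonneg (|x| / b)) (sub_nonneg.2 (one_le_pow₀ (n := 2) h))]
    have h2 := mul_le_mul_of_nonneg_left h1 hb.le
    rw [← sq_abs x, ← (by decide : Even 4).pow_abs x]
    calc 1 / b * |x| ^ 2 - 1 / b ^ 3 * |x| ^ 4 = b * ((|x| / b) ^ 2 - (|x| / b) ^ 4) := by
          field_simp
      _ ≤ b * (|x| / b) := h2
      _ = |x| := by field_simp
  have h4 := iidExpect_sum_pow_four_le (T := T) hp₀ hp d hd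
  have h := iidExpect_mono (T := T) hp₀ fun J => key (∑ t, d (J t))
  rw [iidExpect_sub, iidExpect_const_mul, iidExpect_const_mul, iidExpect_sum_sq hp d hd] at h
  refine le_trans ?_ h
  have h5 := mul_le_mul_of_nonneg_left h4 (by positivity : 0 ≤ 1 / (B * s) ^ 3)
  rw [← hK, hB2, ← hs2] at h5
  refine le_trans (le_of_eq ?_) (sub_le_sub_left h5 _)
  rw [← hs2]
  field_simp
  ring

end iidExpect

namespace Game

variable {N M T : ℕ}

/-- The history of actions and feedback symbols after all `T` time steps. -/
def observed (G : Game N M) (J : Fin T → Fin M) (a : Fin T → Fin N) : Fin T → Fin N × ℝ :=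
  fun s => (a s, G.H (a s) (J s))

/-- The expectation of `F` over the random action sequence that `A` plays against `J`. -/
noncomputable def expect (G : Game N M) (A : Strategy N) (J : Fin T → Fin M)
    (F : (Fin T → Fin N) → ℝ) : ℝ :=
  ∑ a, G.actionProb A J a * F a

theorem observed_snoc (G : Game N M) (J : Fin T → Fin M) (a : Fin T → Fin N) (j : Fin M)
    (x : Fin N) :
    G.observed (Fin.snoc (α := fun _ => Fin M) J j) (Fin.snoc (α := fun _ => Fin N) a x) =
      Fin.snoc (α := fun _ => Fin N × ℝ) (G.observed J a) (x, G.H x j) := by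
  funext s
  refine Fin.lastCases ?_ (fun s => ?_) s <;> simp [observed]

theorem actionProb_snoc (G : Game N M) (A : Strategy N) (J : Fin T → Fin M) (a : Fin T → Fin N)
    (j : Fin M) (x : Fin N) :
    G.actionProb A (Fin.snoc (α := fun _ => Fin M) J j) (Fin.snoc (α := fun _ => Fin N) a x) =
      G.actionProb A J a * (A T (G.observed J a)).1 x := by
  rw [actionProb, Fin.prod_univ_castSucc, Fin.snoc_last]
  congr 1
  · refine Finset.prod_congr rfl fun t _ => ?_
    rw [Fin.snoc_castSucc]
    have : G.history (Fin.snoc (α := fun _ => Fin M) J j) (Fin.snoc (α := fun _ => Fin N) a x)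
        t.castSucc = G.history J a t := by
      funext s
      have hs : Fin.castLE t.castSucc.isLt.le s = (Fin.castLE t.isLt.le s).castSucc := rfl
      simp only [history, hs, Fin.snoc_castSucc]
    rw [this]
    rfl
  · have : G.history (Fin.snoc (α := fun _ => Fin M) J j) (Fin.snoc (α := fun _ => Fin N) a x)
        (Fin.last T) = G.observed J a := by
      funext s
      have hs : Fin.castLE (Fin.last T).isLt.le s = Fin.castSucc s := rfl
      simp only [history, hs, Fin.snoc_castSucc, observed]
    rw [this]
    rfl

theorem expect_zero (G : Game N M) (A : Strategy N) (J : Fin 0 → Fin M)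
    (F : (Fin 0 → Fin N) → ℝ) : G.expect A J F = F ![] := by
  simp [expect, actionProb, Subsingleton.elim (default : Fin 0 → Fin N) ![]]

theorem expect_snoc (G : Game N M) (A : Strategy N) (J : Fin T → Fin M) (j : Fin M)
    (F : (Fin (T + 1) → Fin N) → ℝ) :
    G.expect A (Fin.snoc (α := fun _ => Fin M) J j) F =
      G.expect A J fun a =>
        ∑ x, (A T (G.observed J a)).1 x * F (Fin.snoc (α := fun _ => Fin N) a x) := by
  simp only [expect, sum_snoc, actionProb_snoc, Finset.mul_sum, mul_assoc]

theorem expect_add (G : Game N M) (A : Strategy N) (J : Fin T → Fin M)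
    (F₁ F₂ : (Fin T → Fin N) → ℝ) :
    G.expect A J (fun a => F₁ a + F₂ a) = G.expect A J F₁ + G.expect A J F₂ := by
  simp only [expect, mul_add, Finset.sum_add_distrib]

theorem expect_sub (G : Game N M) (A : Strategy N) (J : Fin T → Fin M)
    (F₁ F₂ : (Fin T → Fin N) → ℝ) :
    G.expect A J (fun a => F₁ a - F₂ a) = G.expect A J F₁ - G.expect A J F₂ := by
  simp only [expect, mul_sub, Finset.sum_sub_distrib]

theorem expect_const (G : Game N M) (A : Strategy N) (J : Fin T → Fin M) (c : ℝ) :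
    G.expect A J (fun _ => c) = c := by
  induction T with
  | zero => exact expect_zero ..
  | succ T ih =>
    rw [← Fin.snoc_init_self J, expect_snoc]
    simpa only [← Finset.sum_mul, (A T _).2.2, one_mul] using ih _

theorem expect_mono (G : Game N M) (A : Strategy N) (J : Fin T → Fin M)
    {F₁ F₂ : (Fin T → Fin N) → ℝ} (h : ∀ a, F₁ a ≤ F₂ a) : G.expect A J F₁ ≤ G.expect A J F₂ :=
  Finset.sum_le_sum fun a _ => mul_le_mul_of_nonneg_left (h a) <|
    Finset.prod_nonneg fun t _ => (A t _).2.1 (a t)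

theorem cumulativeLoss_snoc (G : Game N M) (J : Fin T → Fin M) (a : Fin T → Fin N) (j : Fin M)
    (x : Fin N) :
    G.cumulativeLoss (Fin.snoc (α := fun _ => Fin M) J j) (Fin.snoc (α := fun _ => Fin N) a x) =
      G.cumulativeLoss J a + G.L x j := by
  simp [cumulativeLoss, Fin.sum_univ_castSucc]

theorem regret_eq (G : Game N M) (A : Strategy N) (J : Fin T → Fin M) :
    G.regret A J = G.expect A J (G.cumulativeLoss J) - G.bestFixedLoss J := by
  rw [← G.expect_const A J (G.bestFixedLoss J), ← expect_sub]
  rfl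

theorem bestFixedLoss_le (G : Game N M) (J : Fin T → Fin M) (i : Fin N) :
    G.bestFixedLoss J ≤ ∑ t, G.L i (J t) :=
  ciInf_le (Set.finite_range _).bddBelow i

theorem regret_le_worstRegret (G : Game N M) (A : Strategy N) (J : Fin T → Fin M) :
    G.regret A J ≤ G.worstRegret A T :=
  le_ciSup (f := fun J : Fin T → Fin M => G.regret A J) (Set.finite_range _).bddAbove J

/-- The expectation of `F` when the outcomes are drawn independently with the weights `p` and
Learner plays `A`, conditioned on all but the last time step. The last action depends only on the
history, so the last outcome can be averaged out for each action separately. -/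
theorem iidExpect_expect_succ (G : Game N M) (A : Strategy N) (p : Fin M → ℝ)
    (F : (Fin (T + 1) → Fin M) → (Fin (T + 1) → Fin N) → ℝ) :
    iidExpect p (T + 1) (fun J => G.expect A J (F J)) =
      iidExpect p T fun J => G.expect A J fun a => ∑ x, (A T (G.observed J a)).1 x *
        ∑ j, p j * F (Fin.snoc (α := fun _ => Fin M) J j) (Fin.snoc (α := fun _ => Fin N) a x) := by
  rw [iidExpect_succ]
  congr 1
  funext J
  simp only [expect_snoc]
  simp only [expect, Finset.mul_sum]
  rw [Finset.sum_comm]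
  refine Finset.sum_congr rfl fun a _ => ?_
  rw [Finset.sum_comm]
  exact Finset.sum_congr rfl fun x _ => Finset.sum_congr rfl fun j _ => by ring

/-- Against i.i.d. outcomes, the expected loss of an action sequence can be computed from the mean
losses of the actions. -/
theorem iidExpect_expect_cumulativeLoss (G : Game N M) (A : Strategy N) {p : Fin M → ℝ}
    (hp : ∑ j, p j = 1) :
    iidExpect p T (fun J => G.expect A J (G.cumulativeLoss J)) =
      iidExpect p T fun J => G.expect A J fun a => ∑ t, ∑ j, p j * G.L (a t) j := by
  induction T with
  | zero => simp [iidExpect_zero, expect_zero, cumulativeLoss]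
  | succ T ih =>
    rw [iidExpect_expect_succ, iidExpect_expect_succ]
    simp only [cumulativeLoss_snoc, Fin.sum_univ_castSucc, Fin.snoc_castSucc, Fin.snoc_last,
      mul_add, Finset.sum_add_distrib, ← Finset.sum_mul, hp, (A T _).2.2, one_mul]
    simp only [expect_add, iidExpect_add]
    rw [ih]

/-- If no action can tell `p` from `q` by its feedback, then the histories that a strategy
generates against i.i.d. outcomes have the same law under `p` and under `q`. -/
theorem iidExpect_expect_observed_congr (G : Game N M) (A : Strategy N) {p q : Fin M → ℝ}
    (h : ∀ (i : Fin N) (g : ℝ → ℝ), ∑ j, p j * g (G.H i j) = ∑ j, q j * g (G.H i j))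
    (Φ : (Fin T → Fin N × ℝ) → ℝ) :
    iidExpect p T (fun J => G.expect A J fun a => Φ (G.observed J a)) =
      iidExpect q T fun J => G.expect A J fun a => Φ (G.observed J a) := by
  induction T with
  | zero => simp [iidExpect_zero, expect_zero]
  | succ T ih =>
    rw [iidExpect_expect_succ, iidExpect_expect_succ]
    have hpq : ∀ (o : Fin T → Fin N × ℝ) (x : Fin N),
        ∑ j, p j * Φ (Fin.snoc (α := fun _ => Fin N × ℝ) o (x, G.H x j)) =
          ∑ j, q j * Φ (Fin.snoc (α := fun _ => Fin N × ℝ) o (x, G.H x j)) :=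
      fun o x => h x fun y => Φ (Fin.snoc (α := fun _ => Fin N × ℝ) o (x, y))
    simp only [observed_snoc, hpq]
    exact ih fun o => ∑ x, (A T o).1 x *
      ∑ j, q j * Φ (Fin.snoc (α := fun _ => Fin N × ℝ) o (x, G.H x j))

/-- The Bayesian lower bound: the worst-case regret is at least the mean regret against i.i.d.
outcomes. -/
theorem iidExpect_sub_le_worstRegret (G : Game N M) (A : Strategy N) {p : Fin M → ℝ}
    (hp₀ : ∀ j, 0 ≤ p j) (hp : ∑ j, p j = 1) :
    iidExpect p T (fun J => G.expect A J fun a => ∑ t, ∑ j, p j * G.L (a t) j) -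
      iidExpect p T (fun J => G.bestFixedLoss J) ≤ G.worstRegret A T := by
  rw [← iidExpect_expect_cumulativeLoss G A hp, ← iidExpect_sub,
    ← iidExpect_const (T := T) hp (G.worstRegret A T)]
  refine iidExpect_mono hp₀ fun J => ?_
  rw [← regret_eq]
  exact G.regret_le_worstRegret A J

end Game

/-! ### Elementary bounds on the minimax regret -/

noncomputable instance {N : ℕ} [NeZero N] : Inhabited (Strategy N) :=
  ⟨fun _ _ => ⟨Pi.single 0 1, single_mem_stdSimplex ℝ 0⟩⟩

namespace Game

variable {N M T : ℕ}

theorem exists_bestFixedLoss_eq [NeZero N] (G : Game N M) (J : Fin T → Fin M) :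
    ∃ i, G.bestFixedLoss J = ∑ t, G.L i (J t) := by
  obtain ⟨i, hi⟩ := exists_eq_ciInf_of_finite (f := fun i : Fin N => ∑ t, G.L i (J t))
  exact ⟨i, hi.symm⟩

/-- The worst-case regret is nonnegative: against a constant outcome sequence, no action sequence
beats the action that is best for this outcome. -/
theorem worstRegret_nonneg [NeZero N] (G : Game N M) (A : Strategy N) (T : ℕ) :
    0 ≤ G.worstRegret A T := by
  -- Without outcome sequences (`M = 0 < T`) the supremum is that of the empty set, which is `0`.
  rcases isEmpty_or_nonempty (Fin T → Fin M) with h | ⟨⟨J₀⟩⟩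
  · simp [worstRegret, Real.iSup_of_isEmpty]
  · have : ∃ J : Fin T → Fin M, ∀ t s, J t = J s := by
      rcases Nat.eq_zero_or_pos T with rfl | hT
      · exact ⟨J₀, fun t => t.elim0⟩
      · exact ⟨fun _ => J₀ ⟨0, hT⟩, fun _ _ => rfl⟩
    obtain ⟨J, hJ⟩ := this
    refine le_trans ?_ (G.regret_le_worstRegret A J)
    rw [regret_eq, sub_nonneg, ← G.expect_const A J (G.bestFixedLoss J)]
    refine G.expect_mono A J fun a => ?_
    rcases Nat.eq_zero_or_pos T with rfl | hT
    · simp [bestFixedLoss, cumulativeLoss]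
    · obtain ⟨i, hi⟩ := Finite.exists_min fun i => G.L i (J ⟨0, hT⟩)
      refine (G.bestFixedLoss_le J i).trans (Finset.sum_le_sum fun t _ => ?_)
      rw [hJ t ⟨0, hT⟩]
      exact hi _

theorem bddBelow_range_worstRegret [NeZero N] (G : Game N M) (T : ℕ) :
    BddBelow (Set.range fun A : Strategy N => G.worstRegret A T) :=
  ⟨0, by rintro _ ⟨A, rfl⟩; exact G.worstRegret_nonneg A T⟩

theorem minimaxRegret_nonneg [NeZero N] (G : Game N M) (T : ℕ) : 0 ≤ G.minimaxRegret T :=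
  le_ciInf fun A => G.worstRegret_nonneg A T

/-- Regret bounds for a single strategy bound the minimax regret. The bound has to be nonnegative
because without outcomes the set of regrets can be empty. -/
theorem minimaxRegret_le_of_regret_le [NeZero N] (G : Game N M) (A : Strategy N) {B : ℝ}
    (hB : 0 ≤ B) (h : ∀ J : Fin T → Fin M, G.regret A J ≤ B) : G.minimaxRegret T ≤ B :=
  (ciInf_le (G.bddBelow_range_worstRegret T) A).trans (Real.iSup_le h hB)

theorem minimaxRegret_zero [NeZero N] (G : Game N M) : G.minimaxRegret 0 = 0 := by
  refine le_antisymm (G.minimaxRegret_le_of_regret_le default le_rfl fun J => ?_)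
    (G.minimaxRegret_nonneg 0)
  rw [regret_eq, expect_zero]
  simp [cumulativeLoss, bestFixedLoss]

/-- The strategy that plays action `i` in every time step. -/
noncomputable def constStrategy (i : Fin N) : Strategy N :=
  fun _ _ => ⟨Pi.single i 1, single_mem_stdSimplex ℝ i⟩

theorem constStrategy_apply (i : Fin N) (t : ℕ) (h : Fin t → Fin N × ℝ) :
    (constStrategy i t h).1 = Pi.single i 1 := rfl

/-- If some action is at least as good as all others whatever the outcome, then playing it all the
time has regret `0`. -/
theorem minimaxRegret_eq_zero_of_dominant [NeZero N] (G : Game N M) (i : Fin N)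
    (hi : ∀ k j, G.L i j ≤ G.L k j) (T : ℕ) : G.minimaxRegret T = 0 := by
  refine le_antisymm (G.minimaxRegret_le_of_regret_le (constStrategy i) le_rfl fun J => ?_)
    (G.minimaxRegret_nonneg T)
  have hcum : G.expect (constStrategy i) J (G.cumulativeLoss J) = ∑ t, G.L i (J t) := by
    induction T with
    | zero => simp [expect_zero, cumulativeLoss]
    | succ T ih =>
      rw [← Fin.snoc_init_self J, expect_snoc]
      simp only [constStrategy_apply, cumulativeLoss_snoc, Pi.single_apply, ite_mul, one_mul, zero_mul,
        Finset.sum_ite_eq', Finset.mem_univ, if_true, Fin.sum_univ_castSucc, Fin.snoc_castSucc,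
        Fin.snoc_last]
      rw [expect_add, expect_const, ih]
  rw [regret_eq, hcum, sub_nonpos]
  exact le_ciInf fun k => Finset.sum_le_sum fun t _ => hi k (J t)

theorem exists_minimaxRegret_le_mul [NeZero N] (G : Game N M) :
    ∃ C : ℝ, ∀ T : ℕ, G.minimaxRegret T ≤ C * T := by
  set K := ∑ i, ∑ j, |G.L i j|
  have hK : ∀ i j, |G.L i j| ≤ K := fun i j =>
    (Finset.single_le_sum (f := fun j => |G.L i j|) (fun _ _ => abs_nonneg _)
      (Finset.mem_univ j)).trans
    (Finset.single_le_sum (f := fun i => ∑ j, |G.L i j|)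
      (fun _ _ => Finset.sum_nonneg fun _ _ => abs_nonneg _) (Finset.mem_univ i))
  have hK₀ : 0 ≤ K := Finset.sum_nonneg fun _ _ => Finset.sum_nonneg fun _ _ => abs_nonneg _
  refine ⟨2 * K, fun T => G.minimaxRegret_le_of_regret_le default (by positivity) fun J => ?_⟩
  rw [regret_eq]
  have h1 : G.expect default J (G.cumulativeLoss J) ≤ K * T := by
    rw [← G.expect_const default J (K * T)]
    refine G.expect_mono default J fun a => ?_
    refine (Finset.sum_le_sum fun t _ => (abs_le.1 (hK (a t) (J t))).2).trans (le_of_eq ?_)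
    simp [mul_comm]
  have h2 : -(K * T) ≤ G.bestFixedLoss J := by
    refine le_ciInf fun i => ?_
    refine le_trans (le_of_eq ?_) (Finset.sum_le_sum fun t _ => (abs_le.1 (hK i (J t))).1)
    simp [mul_comm]
  linarith

/-- The minimax regret is monotone along the order `Game.Easier`. -/
theorem Easier.minimaxRegret_le [NeZero N] {G G' : Game N M} (h : G.Easier G') (T : ℕ) :
    G.minimaxRegret T ≤ G'.minimaxRegret T := by
  refine le_ciInf fun A => ?_
  obtain ⟨A', hA'⟩ := h A
  exact G.minimaxRegret_le_of_regret_le A' (G'.worstRegret_nonneg A T) fun J =>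
    (hA' T J).2.trans (G'.regret_le_worstRegret A J)

/-- If the losses of `G` and `G'` differ by an amount that depends only on the outcome, and the
feedback of `G'` is a function of the action and the feedback of `G`, then `G` is easier
than `G'`. -/
theorem easier_of_feedback_eq [NeZero N] {G G' : Game N M} (r : Fin M → ℝ)
    (hL : ∀ i j, G'.L i j = G.L i j + r j) (f : Fin N → ℝ → ℝ)
    (hH : ∀ i j, G'.H i j = f i (G.H i j)) : G.Easier G' := by
  intro A
  let A' : Strategy N := fun t h => A t fun s => ((h s).1, f (h s).1 (h s).2)
  refine ⟨A', fun T J => ?_⟩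
  have hprob : ∀ a : Fin T → Fin N, G.actionProb A' J a = G'.actionProb A J a := fun a => by
    refine Finset.prod_congr rfl fun t _ => ?_
    have : (fun s => ((G.history J a t s).1, f (G.history J a t s).1 (G.history J a t s).2)) =
        G'.history J a t := by
      funext s
      simp only [history, hH]
    rw [← this]
  refine ⟨hprob, le_of_eq ?_⟩
  have hbest : G'.bestFixedLoss J = G.bestFixedLoss J + ∑ t, r (J t) := by
    obtain ⟨i, hi⟩ := G.exists_bestFixedLoss_eq J
    obtain ⟨i', hi'⟩ := G'.exists_bestFixedLoss_eq J
    have h1 := G.bestFixedLoss_le J i'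
    have h2 := G'.bestFixedLoss_le J i
    simp only [hL, Finset.sum_add_distrib] at hi' h2
    linarith
  simp only [regret, hprob, hbest, cumulativeLoss, hL, Finset.sum_add_distrib]
  exact Finset.sum_congr rfl fun a _ => by ring

end Game

/-! ### Exponential weights for bandit games -/

/-- The exponential weights distribution with learning rate `η` for the cumulative losses `s`. -/
noncomputable def expWeights {N : ℕ} [NeZero N] (η : ℝ) (s : Fin N → ℝ) : stdSimplex ℝ (Fin N) :=
  ⟨fun i => Real.exp (-η * s i) / ∑ k, Real.exp (-η * s k),
    fun _ => by positivity, by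
      rw [← Finset.sum_div]
      exact div_self (Finset.sum_pos (fun _ _ => Real.exp_pos _) Finset.univ_nonempty).ne'⟩

/-- The importance-weighted estimates of the cumulative losses of all actions, computed from a
history whose feedback symbols are the losses suffered: a loss is divided by the probability with
which exponential weights chose the action, and the unseen losses are estimated by `0`. -/
noncomputable def lossEstimate {N : ℕ} [NeZero N] (η : ℝ) :
    (t : ℕ) → (Fin t → Fin N × ℝ) → Fin N → ℝ
  | 0, _ => 0
  | t + 1, h =>
    lossEstimate η t (Fin.init h) + Pi.single (h (Fin.last t)).1
      ((h (Fin.last t)).2 / (expWeights η (lossEstimate η t (Fin.init h))).1 (h (Fin.last t)).1)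

/-- The strategy Exp3 with learning rate `η`: exponential weights on the estimated losses. -/
noncomputable def exp3 {N : ℕ} [NeZero N] (η : ℝ) : Strategy N :=
  fun t h => expWeights η (lossEstimate η t h)

section exp3

variable {N M T : ℕ} [NeZero N]

theorem exp3_apply (η : ℝ) (t : ℕ) (h : Fin t → Fin N × ℝ) :
    exp3 η t h = expWeights η (lossEstimate η t h) := rfl

theorem expWeights_pos (η : ℝ) (s : Fin N → ℝ) (i : Fin N) : 0 < (expWeights η s).1 i :=
  div_pos (Real.exp_pos _) (Finset.sum_pos (fun _ _ => Real.exp_pos _) Finset.univ_nonempty)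

theorem exp_neg_le_quadratic {x : ℝ} (hx : 0 ≤ x) : Real.exp (-x) ≤ 1 - x + x ^ 2 := by
  rw [Real.exp_neg, inv_le_iff_one_le_mul₀ (Real.exp_pos x)]
  have h1 : x + 1 ≤ Real.exp x := Real.add_one_le_exp x
  nlinarith [pow_nonneg hx 3, mul_le_mul_of_nonneg_left h1
    (by nlinarith [sq_nonneg (x - 1)] : 0 ≤ 1 - x + x ^ 2)]

/-- The effect of one step of Exp3 on the logarithm of the total weight. -/
theorem log_sum_exp_add_single_le {η : ℝ} (hη : 0 ≤ η) (s : Fin N → ℝ) (x : Fin N) {l : ℝ}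
    (hl : 0 ≤ l) :
    Real.log (∑ k, Real.exp (-η * (s + Pi.single x (l / (expWeights η s).1 x) : Fin N → ℝ) k)) ≤
      Real.log (∑ k, Real.exp (-η * s k)) - η * l + η ^ 2 * l ^ 2 / (expWeights η s).1 x := by
  have hpx := expWeights_pos η s x
  have hW : 0 < ∑ k, Real.exp (-η * s k) :=
    Finset.sum_pos (fun _ _ => Real.exp_pos _) Finset.univ_nonempty
  have hpW : (expWeights η s).1 x * ∑ k, Real.exp (-η * s k) = Real.exp (-η * s x) :=
    div_mul_cancel₀ _ hW.ne'
  set p := (expWeights η s).1 x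
  set W := ∑ k, Real.exp (-η * s k) with hWdef
  have hsum : ∑ k, Real.exp (-η * (s + Pi.single x (l / p) : Fin N → ℝ) k) =
      W * (1 + p * (Real.exp (-(η * (l / p))) - 1)) := by
    have h1 : ∀ k, Real.exp (-η * (s + Pi.single x (l / p) : Fin N → ℝ) k) = Real.exp (-η * s k) +
        if k = x then Real.exp (-η * s x) * (Real.exp (-(η * (l / p))) - 1) else 0 := fun k => by
      by_cases hk : k = x
      · subst hk
        simp only [Pi.add_apply, Pi.single_eq_same, if_true]
        rw [mul_add, Real.exp_add]
        ring_nf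
      · simp [hk]
    simp only [h1, Finset.sum_add_distrib, Finset.sum_ite_eq', Finset.mem_univ, if_true]
    rw [← hWdef, ← hpW]
    ring
  have hpos : 0 < 1 + p * (Real.exp (-(η * (l / p))) - 1) := by
    have : 0 < ∑ k, Real.exp (-η * (s + Pi.single x (l / p) : Fin N → ℝ) k) :=
      Finset.sum_pos (fun _ _ => Real.exp_pos _) Finset.univ_nonempty
    rw [hsum] at this
    exact pos_of_mul_pos_right this hW.le
  rw [hsum, Real.log_mul hW.ne' hpos.ne']
  have h2 := Real.log_le_sub_one_of_pos hpos
  have h3 := mul_le_mul_of_nonneg_left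
    (exp_neg_le_quadratic (by positivity : 0 ≤ η * (l / p))) hpx.le
  have h4 : p * (1 - η * (l / p) + (η * (l / p)) ^ 2) = p - η * l + η ^ 2 * l ^ 2 / p := by
    field_simp
  linarith

namespace Game

theorem lossEstimate_snoc (η : ℝ) (h : Fin T → Fin N × ℝ) (x : Fin N) (y : ℝ) :
    lossEstimate η (T + 1) (Fin.snoc (α := fun _ => Fin N × ℝ) h (x, y)) =
      lossEstimate η T h + Pi.single x (y / (expWeights η (lossEstimate η T h)).1 x) := by
  simp only [lossEstimate, Fin.init_snoc, Fin.snoc_last]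

/-- In a bandit game the loss estimates of Exp3 are unbiased. -/
theorem IsBandit.expect_lossEstimate {G : Game N M} (hG : G.IsBandit) (η : ℝ)
    (J : Fin T → Fin M) (i : Fin N) :
    G.expect (exp3 η) J (fun a => lossEstimate η T (G.observed J a) i) = ∑ t, G.L i (J t) := by
  induction T with
  | zero => simp [expect_zero, lossEstimate]
  | succ T ih =>
    rw [← Fin.snoc_init_self J, expect_snoc]
    simp only [observed_snoc, lossEstimate_snoc, Fin.sum_univ_castSucc, Fin.snoc_castSucc,
      Fin.snoc_last]
    rw [← ih, ← G.expect_const (exp3 η) (Fin.init J) (G.L i (J (Fin.last T))), ← expect_add]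
    congr 1
    funext a
    simp only [exp3_apply, Pi.add_apply, mul_add, Finset.sum_add_distrib, ← Finset.sum_mul]
    rw [(expWeights η _).2.2, one_mul, Finset.sum_eq_single i]
    · rw [Pi.single_eq_same, mul_div_cancel₀ _ (expWeights_pos η _ i).ne', hG]
    · intro x _ hx
      rw [Pi.single_eq_of_ne hx.symm, mul_zero]
    · simp

/-- The potential argument for Exp3: the expectation of the loss suffered plus `1 / η` times the
logarithm of the total weight increases by at most `η K² N` in every step. -/
theorem IsBandit.expect_potential_le {G : Game N M} (hG : G.IsBandit) {η K : ℝ} (hη : 0 < η)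
    (h₀ : ∀ i j, 0 ≤ G.L i j) (hK : ∀ i j, G.L i j ≤ K) (J : Fin T → Fin M) :
    G.expect (exp3 η) J (fun a => G.cumulativeLoss J a +
        1 / η * Real.log (∑ k, Real.exp (-η * lossEstimate η T (G.observed J a) k))) ≤
      1 / η * Real.log N + η * K ^ 2 * N * T := by
  induction T with
  | zero => simp [expect_zero, lossEstimate, cumulativeLoss]
  | succ T ih =>
    rw [← Fin.snoc_init_self J, expect_snoc]
    have hH : G.H = G.L := hG
    have hstep : 1 / η * Real.log N + η * K ^ 2 * N * (T + 1 : ℕ) =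
        (1 / η * Real.log N + η * K ^ 2 * N * T) + η * K ^ 2 * N := by push_cast; ring
    rw [hstep]
    refine le_trans ?_ (add_le_add_left (ih (Fin.init J)) _)
    rw [← G.expect_const (exp3 η) (Fin.init J) (η * K ^ 2 * N), ← expect_add]
    refine G.expect_mono _ _ fun a => ?_
    simp only [observed_snoc, lossEstimate_snoc, cumulativeLoss_snoc, exp3_apply, hH]
    set s := lossEstimate η T (G.observed (Fin.init J) a)
    set c := G.cumulativeLoss (Fin.init J) a
    set w := Real.log (∑ k, Real.exp (-η * s k))
    have hx : ∀ x : Fin N, (expWeights η s).1 x * (c + G.L x (J (Fin.last T)) + 1 / η *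
        Real.log (∑ k, Real.exp (-η * (s + Pi.single x
          (G.L x (J (Fin.last T)) / (expWeights η s).1 x) : Fin N → ℝ) k))) ≤
        (expWeights η s).1 x * (c + 1 / η * w) + η * K ^ 2 := fun x => by
      have hp := expWeights_pos η s x
      have h1 := log_sum_exp_add_single_le hη.le s x (h₀ x (J (Fin.last T)))
      have hl₀ := h₀ x (J (Fin.last T))
      have hlK := hK x (J (Fin.last T))
      generalize G.L x (J (Fin.last T)) = l at h1 hl₀ hlK
      have h2 := mul_le_mul_of_nonneg_left
        (add_le_add_right (mul_le_mul_of_nonneg_left h1 (by positivity : 0 ≤ 1 / η)) (c + l)) hp.le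
      refine h2.trans ?_
      have h3 : (expWeights η s).1 x * (c + l + 1 / η * (w - η * l + η ^ 2 * l ^ 2 /
          (expWeights η s).1 x)) = (expWeights η s).1 x * (c + 1 / η * w) + η * l ^ 2 := by
        field_simp
        ring
      rw [h3]
      gcongr
    refine (Finset.sum_le_sum fun x _ => hx x).trans (le_of_eq ?_)
    rw [Finset.sum_add_distrib, ← Finset.sum_mul, (expWeights η s).2.2]
    simp
    ring

theorem IsBandit.regret_exp3_le {G : Game N M} (hG : G.IsBandit) {η K : ℝ} (hη : 0 < η)
    (h₀ : ∀ i j, 0 ≤ G.L i j) (hK : ∀ i j, G.L i j ≤ K) (J : Fin T → Fin M) :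
    G.regret (exp3 η) J ≤ 1 / η * Real.log N + η * K ^ 2 * N * T := by
  obtain ⟨i, hi⟩ := G.exists_bestFixedLoss_eq J
  rw [regret_eq, hi, ← hG.expect_lossEstimate η J i, ← expect_sub]
  refine le_trans (G.expect_mono _ _ fun a => ?_) (hG.expect_potential_le hη h₀ hK J)
  set s := lossEstimate η T (G.observed J a)
  have h1 : -η * s i ≤ Real.log (∑ k, Real.exp (-η * s k)) := by
    rw [Real.le_log_iff_exp_le
      (Finset.sum_pos (fun _ _ => Real.exp_pos _) Finset.univ_nonempty)]
    exact Finset.single_le_sum (f := fun k => Real.exp (-η * s k))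
      (fun _ _ => (Real.exp_pos _).le) (Finset.mem_univ i)
  have h2 := mul_le_mul_of_nonneg_left h1 (by positivity : 0 ≤ 1 / η)
  have h3 : 1 / η * (-η * s i) = -s i := by field_simp
  linarith

/-- The minimax regret of a bandit game with nonnegative losses is `O(√T)`. -/
theorem IsBandit.exists_minimaxRegret_le_sqrt {G : Game N M} (hG : G.IsBandit)
    (h₀ : ∀ i j, 0 ≤ G.L i j) :
    ∃ C : ℝ, 0 < C ∧ ∀ T : ℕ, G.minimaxRegret T ≤ C * √T := by
  have hK : ∀ i j, G.L i j ≤ ∑ i, ∑ j, G.L i j := fun i j =>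
    (Finset.single_le_sum (f := fun j => G.L i j) (fun _ _ => h₀ _ _) (Finset.mem_univ j)).trans
    (Finset.single_le_sum (f := fun i => ∑ j, G.L i j)
      (fun _ _ => Finset.sum_nonneg fun _ _ => h₀ _ _) (Finset.mem_univ i))
  set K := ∑ i, ∑ j, G.L i j
  have hlog : 0 ≤ Real.log N := Real.log_natCast_nonneg N
  refine ⟨Real.log N + K ^ 2 * N + 1, by positivity, fun T => ?_⟩
  rcases Nat.eq_zero_or_pos T with rfl | hT
  · simp [minimaxRegret_zero]
  have hs : 0 < √(T : ℝ) := by positivity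
  have hs2 : √(T : ℝ) ^ 2 = T := Real.sq_sqrt (by positivity)
  refine G.minimaxRegret_le_of_regret_le (exp3 (1 / √(T : ℝ))) (by positivity) fun J => ?_
  refine (hG.regret_exp3_le (by positivity) h₀ hK J).trans ?_
  rw [← hs2]
  rw [Real.sqrt_sq hs.le]
  have : 1 / (1 / √(T : ℝ)) * Real.log N + 1 / √(T : ℝ) * K ^ 2 * N * √(T : ℝ) ^ 2 =
      (Real.log N + K ^ 2 * N) * √(T : ℝ) := by
    field_simp
  rw [this]
  nlinarith

end Game

end exp3

/-! ### Lower bounds for two actions -/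

namespace Game

variable {M T : ℕ}

/-- The excess loss of action `1` over action `0`. -/
def lossDiff (G : Game 2 M) (j : Fin M) : ℝ := G.L 1 j - G.L 0 j

theorem exists_balanced_distribution (d : Fin M → ℝ) {j₁ j₂ : Fin M} (h₁ : 0 < d j₁)
    (h₂ : d j₂ < 0) :
    ∃ p : Fin M → ℝ, (∀ j, 0 < p j) ∧ ∑ j, p j = 1 ∧ ∑ j, p j * d j = 0 := by
  -- Start from the weights `1` and put more weight on `j₁` or on `j₂` until `d` has mean `0`.
  set S := ∑ j, d j
  set u : Fin M → ℝ := fun j => 1 + (if j = j₁ then max (-S) 0 / d j₁ else 0) +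
    (if j = j₂ then max S 0 / (-d j₂) else 0) with hu
  have hu₀ : ∀ j, 0 < u j := fun j => by
    have := neg_pos.2 h₂
    simp only [hu]
    split_ifs <;> positivity
  have hud : ∑ j, u j * d j = 0 := by
    simp only [hu, add_mul, one_mul, Finset.sum_add_distrib, ite_mul, zero_mul,
      Finset.sum_ite_eq', Finset.mem_univ, if_true]
    have e1 : max (-S) 0 / d j₁ * d j₁ = max (-S) 0 := div_mul_cancel₀ _ h₁.ne'
    have e2 : max S 0 / (-d j₂) * d j₂ = -max S 0 := by
      rw [div_neg, neg_mul, div_mul_cancel₀ _ h₂.ne]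
    rw [e1, e2]
    rcases le_total S 0 with h | h
    · rw [max_eq_left (by linarith), max_eq_right h]; ring_nf; exact sub_self S
    · rw [max_eq_right (by linarith), max_eq_left h]; ring_nf; exact sub_self S
  have hsum : 0 < ∑ j, u j := Finset.sum_pos (fun j _ => hu₀ j) ⟨j₁, Finset.mem_univ _⟩
  refine ⟨fun j => u j / ∑ k, u k, fun j => div_pos (hu₀ j) hsum, ?_, ?_⟩
  · rw [← Finset.sum_div, div_self hsum.ne']
  · simp only [div_mul_eq_mul_div]
    rw [← Finset.sum_div, hud, zero_div]

/-- If both actions have the same mean loss under `p`, then no strategy can profit from its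
observations, and the regret against i.i.d. outcomes is the fluctuation of the loss difference. -/
theorem exists_sqrt_le_minimaxRegret (G : Game 2 M) {p : Fin M → ℝ} (hp₀ : ∀ j, 0 ≤ p j)
    (hp : ∑ j, p j = 1) (hd : ∑ j, p j * G.lossDiff j = 0)
    (hv : 0 < ∑ j, p j * G.lossDiff j ^ 2) :
    ∃ c : ℝ, 0 < c ∧ ∀ T : ℕ, c * √T ≤ G.minimaxRegret T := by
  obtain ⟨c, hc, h⟩ := exists_sqrt_le_iidExpect_abs_sum hp₀ hp G.lossDiff hd hv
  refine ⟨c / 2, by positivity, fun T => le_ciInf fun A => ?_⟩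
  set m := ∑ j, p j * G.L 0 j with hm
  have hL : ∀ i, ∑ j, p j * G.L i j = m := by
    rw [Fin.forall_fin_two]
    refine ⟨rfl, ?_⟩
    simp only [lossDiff, mul_sub, Finset.sum_sub_distrib] at hd
    linarith
  refine le_trans ?_ (G.iidExpect_sub_le_worstRegret A hp₀ hp)
  simp only [hL, Finset.sum_const, Finset.card_univ, Fintype.card_fin, nsmul_eq_mul, expect_const,
    iidExpect_const hp]
  have hbest : ∀ J : Fin T → Fin M, G.bestFixedLoss J ≤
      1 / 2 * (∑ t, (G.L 0 (J t) + G.L 1 (J t))) - 1 / 2 * |∑ t, G.lossDiff (J t)| := fun J => by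
    have h0 := G.bestFixedLoss_le J 0
    have h1 := G.bestFixedLoss_le J 1
    simp only [lossDiff, Finset.sum_add_distrib, Finset.sum_sub_distrib]
    rcases abs_cases (∑ t, G.L 1 (J t) - ∑ t, G.L 0 (J t)) with ⟨e, _⟩ | ⟨e, _⟩ <;>
      rw [e] <;> linarith
  have h1 := iidExpect_mono (T := T) hp₀ hbest
  rw [iidExpect_sub, iidExpect_const_mul, iidExpect_const_mul,
    iidExpect_sum hp fun j => G.L 0 j + G.L 1 j] at h1
  simp only [mul_add, Finset.sum_add_distrib, hL] at h1
  linarith [h T]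

/-- If a perturbation `v` of the outcome distribution is invisible to the feedback of both actions
but changes the mean of the loss difference, then the minimax regret grows linearly: Learner behaves
in the same way under `p + ε v` and `p - ε v`, while different actions are optimal by a margin. -/
theorem exists_mul_le_minimaxRegret (G : Game 2 M) {p : Fin M → ℝ} (hp₀ : ∀ j, 0 < p j)
    (hp : ∑ j, p j = 1) (hd : ∑ j, p j * G.lossDiff j = 0) {v : Fin M → ℝ}
    (hv : ∀ (i : Fin 2) (g : ℝ → ℝ), ∑ j, v j * g (G.H i j) = 0)
    (hvd : 0 < ∑ j, v j * G.lossDiff j) :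
    ∃ c : ℝ, 0 < c ∧ ∀ T : ℕ, c * T ≤ G.minimaxRegret T := by
  obtain ⟨ε, hε, hεp⟩ : ∃ ε : ℝ, 0 < ε ∧ ∀ j, |ε * v j| ≤ p j := by
    have hM : Nonempty (Fin M) := by
      by_contra h
      rw [not_nonempty_iff] at h
      simp at hp
    obtain ⟨k, hk⟩ := Finite.exists_min p
    have hV : 0 ≤ ∑ j, |v j| := Finset.sum_nonneg fun _ _ => abs_nonneg _
    refine ⟨p k / (1 + ∑ j, |v j|), div_pos (hp₀ k) (by positivity), fun j => ?_⟩
    have h1 := Finset.single_le_sum (f := fun j => |v j|) (fun _ _ => abs_nonneg _)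
      (Finset.mem_univ j)
    rw [abs_mul, abs_of_pos (div_pos (hp₀ k) (by positivity)), div_mul_eq_mul_div]
    refine le_trans ?_ (hk j)
    rw [div_le_iff₀ (by positivity)]
    exact mul_le_mul_of_nonneg_left (by linarith) (hp₀ k).le
  have hv0 : ∑ j, v j = 0 := by simpa using hv 0 fun _ => 1
  set q : ℝ → Fin M → ℝ := fun s j => p j + s * (ε * v j) with hq
  have hq₀ : ∀ s : ℝ, |s| = 1 → ∀ j, 0 ≤ q s j := fun s hs j => by
    have h1 := neg_abs_le (s * (ε * v j))
    rw [abs_mul, hs, one_mul] at h1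
    have := hεp j
    simp only [hq]
    linarith
  have hqg : ∀ (s : ℝ) (g : Fin M → ℝ),
      ∑ j, q s j * g j = ∑ j, p j * g j + s * ε * ∑ j, v j * g j := fun s g => by
    simp only [hq, add_mul, Finset.sum_add_distrib, Finset.mul_sum]
    congr 1
    exact Finset.sum_congr rfl fun j _ => by ring
  have hq1 : ∀ s, ∑ j, q s j = 1 := fun s => by
    have := hqg s fun _ => 1
    simpa [hp, hv0] using this
  have hqH : ∀ (i : Fin 2) (g : ℝ → ℝ),
      ∑ j, q (-1) j * g (G.H i j) = ∑ j, q 1 j * g (G.H i j) := fun i g => by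
    rw [hqg _ fun j => g (G.H i j), hqg _ fun j => g (G.H i j), hv i g, mul_zero, mul_zero]
  set δ := ε * ∑ j, v j * G.lossDiff j with hδ
  have hδ₀ : 0 < δ := mul_pos hε hvd
  -- Under `q 1` action `0` is better by `δ`, under `q (-1)` action `1` is better by `δ`.
  set ℓ : ℝ → Fin 2 → ℝ := fun s i => ∑ j, q s j * G.L i j with hℓ
  have hdiff : ∀ s, ℓ s 1 - ℓ s 0 = s * δ := fun s => by
    have := hqg s G.lossDiff
    rw [hd, zero_add, mul_assoc, ← hδ] at this
    rw [← this]
    simp only [hℓ, lossDiff, mul_sub, Finset.sum_sub_distrib]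
  refine ⟨δ / 2, by positivity, fun T => le_ciInf fun A => ?_⟩
  have hbest : ∀ s : ℝ, |s| = 1 → ∀ i, iidExpect (q s) T (fun J => G.bestFixedLoss J) ≤ T * ℓ s i :=
    fun s hs i => (iidExpect_mono (hq₀ s hs) fun J => G.bestFixedLoss_le J i).trans
      (le_of_eq (iidExpect_sum (hq1 s) _))
  have h1 := G.iidExpect_sub_le_worstRegret (T := T) A (hq₀ 1 (by norm_num)) (hq1 1)
  have h2 := G.iidExpect_sub_le_worstRegret (T := T) A (hq₀ (-1) (by norm_num)) (hq1 (-1))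
  have h3 := hbest 1 (by norm_num) 0
  have h4 := hbest (-1) (by norm_num) 1
  have h5 := G.iidExpect_expect_observed_congr (T := T) A hqH
    fun o => ∑ t, ∑ j, q (-1) j * G.L (o t).1 j
  simp only [observed] at h5
  rw [h5] at h2
  have hact : ∀ i, ℓ 1 i + ℓ (-1) i = ℓ 1 0 + ℓ (-1) 1 + δ := by
    rw [Fin.forall_fin_two]
    constructor <;> linarith [hdiff 1, hdiff (-1)]
  have h6 : iidExpect (q 1) T (fun J => G.expect A J fun a => ∑ t, ∑ j, q 1 j * G.L (a t) j) +
      iidExpect (q 1) T (fun J => G.expect A J fun a => ∑ t, ∑ j, q (-1) j * G.L (a t) j) =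
      T * (ℓ 1 0 + ℓ (-1) 1 + δ) := by
    rw [← iidExpect_add]
    simp only [← expect_add, ← Finset.sum_add_distrib]
    rw [← iidExpect_const (T := T) (hq1 1) (T * (ℓ 1 0 + ℓ (-1) 1 + δ))]
    congr 1
    funext J
    rw [← G.expect_const A J (T * (ℓ 1 0 + ℓ (-1) 1 + δ))]
    congr 1
    funext a
    simp only [Finset.sum_add_distrib]
    rw [← Finset.sum_add_distrib, Finset.sum_congr rfl fun t _ => hact (a t), Finset.sum_const,
      Finset.card_univ, Fintype.card_fin, nsmul_eq_mul]
  linarith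

/-! ### The dichotomy for two actions -/

/-- Either the loss difference can be estimated without bias from the feedback, or linear duality
provides a perturbation of the outcome distribution that the feedback does not reveal. -/
theorem exists_estimator_or_exists_perturbation (G : Game 2 M) :
    (∃ f : Fin 2 → ℝ → ℝ, ∀ j, G.lossDiff j = f 1 (G.H 1 j) - f 0 (G.H 0 j)) ∨
      ∃ v : Fin M → ℝ, (∀ (i : Fin 2) (g : ℝ → ℝ), ∑ j, v j * g (G.H i j) = 0) ∧
        0 < ∑ j, v j * G.lossDiff j := by
  let Ψ : (Fin 2 → ℝ → ℝ) →ₗ[ℝ] (Fin M → ℝ) :=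
    { toFun := fun f j => f 1 (G.H 1 j) - f 0 (G.H 0 j)
      map_add' := fun f g => by funext j; simp only [Pi.add_apply]; ring
      map_smul' := fun c f => by
        funext j; simp only [Pi.smul_apply, smul_eq_mul, RingHom.id_apply]; ring }
  by_cases h : G.lossDiff ∈ LinearMap.range Ψ
  · obtain ⟨f, hf⟩ := h
    exact Or.inl ⟨f, fun j => (congrFun hf j).symm⟩
  · right
    obtain ⟨φ, hφ, hker⟩ := Submodule.exists_le_ker_of_notMem h
    have hφsum : ∀ u : Fin M → ℝ, φ u = ∑ j, φ (Pi.single j 1) * u j := fun u => by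
      rw [φ.pi_apply_eq_sum_univ u]
      refine Finset.sum_congr rfl fun j _ => ?_
      rw [smul_eq_mul, mul_comm]
      congr 2
      funext k
      simp [Pi.single_apply, eq_comm]
    have hzero : ∀ f : Fin 2 → ℝ → ℝ, ∑ j, φ (Pi.single j 1) * (f 1 (G.H 1 j) - f 0 (G.H 0 j)) = 0 := fun f => by
      have : φ (Ψ f) = 0 := hker ⟨f, rfl⟩
      rw [hφsum] at this
      exact this
    have hv : ∀ (i : Fin 2) (g : ℝ → ℝ), ∑ j, φ (Pi.single j 1) * g (G.H i j) = 0 := by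
      rw [Fin.forall_fin_two]
      refine ⟨fun g => ?_, fun g => ?_⟩
      · simpa using hzero ![g, 0]
      · simpa using hzero ![0, g]
    rw [hφsum] at hφ
    rcases lt_or_gt_of_ne hφ with hlt | hgt
    · exact ⟨fun j => -φ (Pi.single j 1), by simpa using hv, by simpa using hlt⟩
    · exact ⟨fun j => φ (Pi.single j 1), hv, hgt⟩

/-- If the loss difference can be estimated from the feedback, then the estimates are the losses of
a bandit game that is harder than `G`; a common shift makes them nonnegative. -/
theorem exists_bandit_of_estimator (G : Game 2 M) {f : Fin 2 → ℝ → ℝ}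
    (hf : ∀ j, G.lossDiff j = f 1 (G.H 1 j) - f 0 (G.H 0 j)) :
    ∃ G' : Game 2 M, G'.IsBandit ∧ (∀ i j, 0 ≤ G'.L i j) ∧ G.Easier G' := by
  set K := ∑ i, ∑ j, |f i (G.H i j)|
  have hK : ∀ i j, |f i (G.H i j)| ≤ K := fun i j =>
    (Finset.single_le_sum (f := fun j => |f i (G.H i j)|) (fun _ _ => abs_nonneg _)
      (Finset.mem_univ j)).trans
    (Finset.single_le_sum (f := fun i => ∑ j, |f i (G.H i j)|)
      (fun _ _ => Finset.sum_nonneg fun _ _ => abs_nonneg _) (Finset.mem_univ i))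
  refine ⟨⟨fun i j => f i (G.H i j) + K, fun i j => f i (G.H i j) + K⟩, rfl, fun i j => ?_,
    easier_of_feedback_eq (fun j => f 0 (G.H 0 j) + K - G.L 0 j) ?_ (fun i y => f i y + K)
      fun _ _ => rfl⟩
  · have := (abs_le.1 (hK i j)).1
    simp only
    linarith
  · rw [Fin.forall_fin_two]
    refine ⟨fun j => by ring, fun j => ?_⟩
    have := hf j
    simp only [lossDiff] at this ⊢
    linarith

end Game

end PartialMonitoring

theorem mainTheorem1 (M : ℕ) (G : PartialMonitoring.Game 2 M) (hG : ¬ G.IsTrivial) :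
    (∃ G' : PartialMonitoring.Game 2 M, G'.IsBandit ∧ G.Easier G') ∧
      ∃ c C : ℝ, 0 < c ∧ 0 < C ∧ ∀ T : ℕ,
        c * Real.sqrt (T : ℝ) ≤ G.minimaxRegret T ∧
          G.minimaxRegret T ≤ C * Real.sqrt (T : ℝ) := by
  have hzero : ¬ ∀ T, G.minimaxRegret T = 0 := fun h => hG (Or.inl h)
  obtain ⟨j₁, h₁⟩ : ∃ j, 0 < G.lossDiff j := by
    by_contra! h
    refine hzero (G.minimaxRegret_eq_zero_of_dominant 1 ?_)
    rw [Fin.forall_fin_two]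
    exact ⟨fun j => sub_nonpos.1 (h j), fun j => le_rfl⟩
  obtain ⟨j₂, h₂⟩ : ∃ j, G.lossDiff j < 0 := by
    by_contra! h
    refine hzero (G.minimaxRegret_eq_zero_of_dominant 0 ?_)
    rw [Fin.forall_fin_two]
    exact ⟨fun j => le_rfl, fun j => sub_nonneg.1 (h j)⟩
  obtain ⟨p, hp₀, hp, hpd⟩ := PartialMonitoring.Game.exists_balanced_distribution G.lossDiff h₁ h₂
  rcases G.exists_estimator_or_exists_perturbation with ⟨f, hf⟩ | ⟨v, hv, hvd⟩
  · obtain ⟨G', hG', hnonneg, heasier⟩ := G.exists_bandit_of_estimator hf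
    refine ⟨⟨G', hG', heasier⟩, ?_⟩
    have hvar : 0 < ∑ j, p j * G.lossDiff j ^ 2 :=
      Finset.sum_pos' (fun j _ => mul_nonneg (hp₀ j).le (sq_nonneg _))
        ⟨j₁, Finset.mem_univ _, mul_pos (hp₀ j₁) (pow_pos h₁ 2)⟩
    obtain ⟨c, hc, hlower⟩ := G.exists_sqrt_le_minimaxRegret (fun j => (hp₀ j).le) hp hpd hvar
    obtain ⟨C, hC, hupper⟩ := hG'.exists_minimaxRegret_le_sqrt hnonneg
    exact ⟨c, C, hc, hC, fun T => ⟨hlower T, (heasier.minimaxRegret_le T).trans (hupper T)⟩⟩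
  · obtain ⟨c, hc, hlower⟩ := G.exists_mul_le_minimaxRegret hp₀ hp hpd hv hvd
    obtain ⟨C, hupper⟩ := G.exists_minimaxRegret_le_mul
    refine absurd (Or.inr ⟨IsBigO.of_bound C ?_, IsBigO.of_bound c⁻¹ ?_⟩) hG <;>
      refine Eventually.of_forall fun T => ?_ <;>
      rw [Real.norm_of_nonneg (G.minimaxRegret_nonneg T), Real.norm_of_nonneg (Nat.cast_nonneg T)]
    · exact hupper T
    · rw [inv_mul_eq_div, le_div_iff₀ hc, mul_comm]
      exact hlower T
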